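/- Let $X$ be a Kan complex with basepoint $*\in X_0$ (also writing $*$ for the simplicial subset consisting of this vertex and its degeneracies), and let $n\ge 1$. * Two $n$-simplices $x,x'\in X_n$ are called homotopic if $d_ix=d_ix'$ for $0\le i\le n$ and there is $y\in X_{n+1}$ with $d_ny=x$, $d_{n+1}y=x'$ and $d_iy=s_{n-1}d_ix=s_{n-1}d_ix'$ for $0\le i\le n-1$. * $\pi_n^{\mathrm{simp}}(X,*)$ is the set of $n$-simplices $x$ with $d_ix\in *$ for $0\le i\le n$, modulo homotopy of simplices. * $\pi_n^{\mathrm{sph}}(X,*)$ is the set of simplicial maps $(\partial\Delta^{n+1},[0])\to(X,*)$, modulo simplicial homotopy $\partial\Delta^{n+1}\times\Delta^1\to X$ relative to the basepoint. * $\pi_n^{\mathrm{disk}}(X,*)$ is the set of simplicial maps $(\Delta^n,\partial\Delta^n)\to(X,*)$, modulo simplicial homotopy relative to $\partial\Delta^n$. Then: 1. The three homotopy relations used here are equivalence relations. 2. Two arbitrary $n$-simplices $x,x'$ of $X$ are homotopic if and only if the maps $\Delta^n\to X$ representing them are homotopic relative to $\partial\Delta^n$, that is, through a homotopy $\Delta^n\times\Delta^1\to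 X$ whose restriction to $\partial\Delta^n\times\Delta^1$ factors through the projection to $\partial\Delta^n$. 3. Every $n$-simplex $x$ with all faces in $*$ is represented by a unique map $g_x:(\Delta^n,\partial\Delta^n)\to(X,*)$, and for every map $g:(\Delta^n,\partial\Delta^n)\to(X,*)$ there is a unique map $f_g:(\partial\Delta^{n+1},[0])\to(X,*)$ that equals $g$ on the face $d_0\Delta^{n+1}$ and is constant at $*$ on the faces $d_i\Delta^{n+1}$, $i>0$. The assignments $x\mapsto g_x$ and $g\mapsto f_g$ induce bijections $$\pi_n^{\mathrm{simp}}(X,*)\;\cong\;\pi_n^{\mathrm{disk}}(X,*)\;\cong\;\pi_n^{\mathrm{sph}}(X,*).$$ In particular, the definition of $\pi_n(X,*)$ by maps of spheres and the definition by simplices with all faces at the basepoint agree. -/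

import Mathlib

open CategoryTheory Simplicial MonoidalCategory CartesianMonoidalCategory Opposite

universe u

namespace KanPi

/-- The basepoint of a simplicial set `X` determined by a vertex `pt`: the simplicial subset
consisting of `pt` and all its degeneracies. -/
abbrev basepoint {X : SSet.{u}} (pt : X _⦋0⦌) : X.Subcomplex :=
  SSet.Subcomplex.ofSimplex pt

/-- The vertex `[0]` of the boundary of the standard simplex of dimension `n + 2`. -/
def vertexZero (n : ℕ) : (∂Δ[n + 2] : SSet.{u}) _⦋0⦌ :=
  ⟨SSet.stdSimplex.obj₀Equiv.symm 0, by
    rw [SSet.boundary_obj_eq_univ 0 (n + 2)]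
    exact Set.mem_univ _⟩

/-- Simplicial maps of pairs from the boundary of the standard `(n + 2)`-simplex, with basepoint
generated by the vertex `[0]`, to `X`, with basepoint generated by `pt`. (A map into the
basepoint is necessarily constant.) -/
abbrev PointedSphere {X : SSet.{u}} (pt : X _⦋0⦌) (n : ℕ) : Type u :=
  SSet.RelativeMorphism (basepoint (vertexZero.{u} n)) (basepoint pt)
    (SSet.const ⟨pt, SSet.Subcomplex.mem_ofSimplex_obj pt⟩)

/-- The first definition of the homotopy group, in dimension `n + 1 > 0`: homotopy classes,
relative to the basepoint, of pointed maps from the boundary of the `(n + 2)`-simplex. -/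
abbrev PiSphere {X : SSet.{u}} (pt : X _⦋0⦌) (n : ℕ) : Type u :=
  SSet.RelativeMorphism.HomotopyClass (basepoint (vertexZero.{u} n)) (basepoint pt)
    (SSet.const ⟨pt, SSet.Subcomplex.mem_ofSimplex_obj pt⟩)

/-- Homotopy of two simplices of dimension `n + 1`: they have the same faces, and they are the
last two faces of a simplex of dimension `n + 2` all of whose other faces are the last
degeneracies of the corresponding faces of the two simplices. -/
def SimplexHomotopic {X : SSet.{u}} {n : ℕ} (x x' : X _⦋n + 1⦌) : Prop :=
  (∀ i : Fin (n + 2), X.δ i x = X.δ i x') ∧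
    ∃ y : X _⦋n + 2⦌,
      X.δ (Fin.last (n + 1)).castSucc y = x ∧
      X.δ (Fin.last (n + 2)) y = x' ∧
      ∀ i : Fin (n + 1),
        X.δ i.castSucc.castSucc y = X.σ (Fin.last n) (X.δ i.castSucc x)

/-- The simplices of dimension `n + 1` all of whose faces lie in the basepoint. -/
def SphericalSimplex {X : SSet.{u}} (pt : X _⦋0⦌) (n : ℕ) : Type u :=
  {x : X _⦋n + 1⦌ // ∀ i : Fin (n + 2), X.δ i x ∈ (basepoint pt).obj (op ⦋n⦌)}

/-- The second definition of the homotopy group, in dimension `n + 1 > 0`: simplices all of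
whose faces lie in the basepoint, up to homotopy of simplices. -/
def PiSimplex {X : SSet.{u}} (pt : X _⦋0⦌) (n : ℕ) : Type u :=
  Quot fun x x' : SphericalSimplex pt n ↦ SimplexHomotopic x.1 x'.1

/-- Homotopy classes, relative to the boundary, of maps from the standard `(n + 1)`-simplex to
`X` which send the boundary to the basepoint. -/
abbrev PiDisk {X : SSet.{u}} (pt : X _⦋0⦌) (n : ℕ) : Type u :=
  SSet.RelativeMorphism.HomotopyClass ∂Δ[n + 1] (basepoint pt)
    (SSet.const ⟨pt, SSet.Subcomplex.mem_ofSimplex_obj pt⟩)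

/-- Two simplicial maps `f g : K ⟶ Y` are homotopic relative to the simplicial subset `A`: there
is a homotopy whose restriction to `A × I` factors through the projection to `A`. -/
def HomotopicRel {K Y : SSet.{u}} (A : K.Subcomplex) (f g : K ⟶ Y) : Prop :=
  ∃ H : K ⊗ Δ[1] ⟶ Y, SSet.ι₀ ≫ H = f ∧ SSet.ι₁ ≫ H = g ∧
    ∃ a : (A : SSet) ⟶ Y, A.ι ▷ Δ[1] ≫ H = fst _ _ ≫ a

/-- The map `f` on the boundary of the `(n + 2)`-simplex is given by the map `g` on the face
opposite to the vertex `[0]`, and is constant at the basepoint on all other faces. -/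
def IsCollapseExtension {X : SSet.{u}} {pt : X _⦋0⦌} {n : ℕ}
    (g : X.PtSimplex (n + 1) pt) (f : PointedSphere pt n) : Prop :=
  SSet.boundary.ι 0 ≫ f.map = g.map ∧
    ∀ i : Fin (n + 3), i ≠ 0 → SSet.boundary.ι i ≫ f.map = SSet.const pt

end KanPi

namespace KanPi
open SSet MonoidalClosed Limits

/-! For a monomorphism `A ⟶ K` and a Kan complex `X`, restriction `X^K ⟶ X^A` is a Kan fibration. By
adjunction, homotopies on `K` can therefore be extended, composed and inverted over prescribed data
on `A` (`exists_tensor_filler`). This makes relative homotopy an equivalence relation. A simplex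
homotopy is a relative homotopy obtained by collapsing the prism to a simplex. Conversely, the
homotopy extension property applied to a degenerate simplex turns a relative homotopy into a simplex
homotopy (`simplexHomotopic_iff`). Disks and spheres are compared by writing the sphere as the face
`d₀` glued to the horn `Λ[n + 2, 0]`, which contracts to the vertex `[0]`. Dragging the horn to the
basepoint makes every sphere a collapse extension (`exists_isCollapseExtension_homotopy`). The same
contraction makes a homotopy of such spheres constant on the horn (`exists_homotopy_const_on_horn`).
-/

/-! ### Extension and composition of homotopies in a Kan complex -/

lemma whiskerLeft_δ_one (K : SSet.{u}) :
    K ◁ stdSimplex.δ (1 : Fin 2) = fst K Δ[0] ≫ ι₀ := by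
  rw [stdSimplex.δ_one_eq_const]; rfl

lemma whiskerLeft_δ_zero (K : SSet.{u}) :
    K ◁ stdSimplex.δ (0 : Fin 2) = fst K Δ[0] ≫ ι₁ := by
  rw [stdSimplex.δ_zero_eq_const]; rfl

/-- The inclusion `K ⟶ K ⊗ Δ[n]` of a vertex of the second factor. -/
noncomputable def vertexι (K : SSet.{u}) {n : ℕ} (j : Fin (n + 1)) : K ⟶ K ⊗ Δ[n] :=
  lift (𝟙 K) (SSet.const (stdSimplex.obj₀Equiv.symm j))

lemma vertexι_whiskerLeft (K : SSet.{u}) {n m : ℕ} (j : Fin (n + 1)) (φ : Δ[n] ⟶ Δ[m])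
    (j' : Fin (m + 1)) (h : φ.app _ (stdSimplex.obj₀Equiv.symm j) = stdSimplex.obj₀Equiv.symm j') :
    vertexι K j ≫ K ◁ φ = vertexι K j' := by
  rw [vertexι, lift_whiskerLeft, const_comp, h, vertexι]

lemma vertexι_δ_comp (K : SSet.{u}) {X : SSet.{u}} {n : ℕ} (j : Fin (n + 1)) (i : Fin (n + 2))
    (f : K ⊗ Δ[n + 1] ⟶ X) :
    vertexι K j ≫ K ◁ stdSimplex.δ i ≫ f = vertexι K (i.succAbove j) ≫ f := by
  rw [← Category.assoc, vertexι_whiskerLeft _ _ _ (i.succAbove j) (by ext k; rfl)]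

lemma cancel_fst {K X : SSet.{u}} {f g : K ⟶ X} (h : fst K Δ[0] ≫ f = fst K Δ[0] ≫ g) :
    f = g := by
  simpa [vertexι] using vertexι K 0 ≫= h

section fill
variable {A K X : SSet.{u}} [KanComplex X] (i : A ⟶ K) [Mono i]

-- By currying, this is a horn lifting problem against the Kan fibration `X^K ⟶ X^A`.
open modelCategoryQuillen HomotopicalAlgebra in
lemma exists_tensor_filler {n : ℕ} (k : Fin (n + 2)) (W : A ⊗ Δ[n + 1] ⟶ X)
    (f : ∀ j : Fin (n + 2), j ≠ k → (K ⊗ Δ[n] ⟶ X))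
    (hf : horn.IsCompatible fun j hj ↦ curry (f j hj))
    (hW : ∀ (j : Fin (n + 2)) (hj : j ≠ k), i ▷ _ ≫ f j hj = A ◁ stdSimplex.δ j ≫ W) :
    ∃ Y : K ⊗ Δ[n + 1] ⟶ X, i ▷ _ ≫ Y = W ∧
      ∀ (j : Fin (n + 2)) (hj : j ≠ k), K ◁ stdSimplex.δ j ≫ Y = f j hj := by
  obtain ⟨φ, h₁, h₂⟩ := hf.exists_lift ((pre i).app X) (curry W) (fun j hj ↦ by
    rw [curry_pre_app, hW, curry_natural_left])
  refine ⟨uncurry φ, ?_, fun j hj ↦ ?_⟩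
  · rw [← uncurry_pre_app, h₂, uncurry_curry]
  · rw [← uncurry_natural_left, h₁, uncurry_curry]

/-- The horn `Λ[1, 0]` is the vertex `0`, so the homotopy extension property is the lowest case of
the filler. -/
lemma exists_homotopy_extension_ι₀ (W : A ⊗ Δ[1] ⟶ X) (f : K ⟶ X) (h : i ≫ f = ι₀ ≫ W) :
    ∃ Y : K ⊗ Δ[1] ⟶ X, i ▷ _ ≫ Y = W ∧ ι₀ ≫ Y = f := by
  obtain ⟨Y, h₁, h₂⟩ := exists_tensor_filler i (n := 0) 0 W (fun _ _ ↦ fst _ _ ≫ f) trivial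
    (fun j hj ↦ by
      obtain rfl : j = 1 := by grind
      rw [whiskerLeft_δ_one, Category.assoc, ← h, whiskerRight_fst_assoc])
  refine ⟨Y, h₁, cancel_fst ?_⟩
  rw [← h₂ 1 (by simp), whiskerLeft_δ_one, Category.assoc]

lemma exists_homotopy_extension_ι₁ (W : A ⊗ Δ[1] ⟶ X) (f : K ⟶ X) (h : i ≫ f = ι₁ ≫ W) :
    ∃ Y : K ⊗ Δ[1] ⟶ X, i ▷ _ ≫ Y = W ∧ ι₁ ≫ Y = f := by
  obtain ⟨Y, h₁, h₂⟩ := exists_tensor_filler i (n := 0) 1 W (fun _ _ ↦ fst _ _ ≫ f) trivial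
    (fun j hj ↦ by
      obtain rfl : j = 0 := by grind
      rw [whiskerLeft_δ_zero, Category.assoc, ← h, whiskerRight_fst_assoc])
  refine ⟨Y, h₁, cancel_fst ?_⟩
  rw [← h₂ 0 (by simp), whiskerLeft_δ_zero, Category.assoc]

/-- Composition of two homotopies, over a prescribed composition of their restrictions. -/
lemma exists_homotopy_comp (W : A ⊗ Δ[2] ⟶ X) (a b : K ⊗ Δ[1] ⟶ X)
    (hab : ι₁ ≫ a = ι₀ ≫ b) (ha : i ▷ _ ≫ a = A ◁ stdSimplex.δ 2 ≫ W)
    (hb : i ▷ _ ≫ b = A ◁ stdSimplex.δ 0 ≫ W) :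
    ∃ c : K ⊗ Δ[1] ⟶ X, i ▷ _ ≫ c = A ◁ stdSimplex.δ 1 ≫ W ∧ ι₀ ≫ c = ι₀ ≫ a ∧
      ι₁ ≫ c = ι₁ ≫ b := by
  -- Here `a` and `b` are the edges `01` and `12` of a triangle; the edge `02` of the filler is the
  -- composite.
  obtain ⟨Y, h₁, h₂⟩ := exists_tensor_filler i (n := 1) 1 W (fun j _ ↦ if j = 0 then b else a)
    (by
      rw [horn.isCompatible_iff]
      intro j k hj hk hjk
      obtain rfl : j = 0 := by grind
      obtain rfl : k = 2 := by grind
      change stdSimplex.δ 1 ≫ curry b = stdSimplex.δ 0 ≫ curry a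
      rw [← curry_natural_left, ← curry_natural_left, whiskerLeft_δ_one, whiskerLeft_δ_zero,
        Category.assoc, Category.assoc, hab])
    (fun j hj ↦ by
      obtain rfl | rfl : j = 0 ∨ j = 2 := by grind
      · exact hb
      · exact ha)
  have h0 : K ◁ stdSimplex.δ 0 ≫ Y = b := h₂ 0 (by simp)
  have h2 : K ◁ stdSimplex.δ 2 ≫ Y = a := h₂ 2 (by simp)
  refine ⟨K ◁ stdSimplex.δ 1 ≫ Y, ?_, ?_, ?_⟩
  · rw [← whisker_exchange_assoc, h₁]
  · rw [← h2]
    exact (vertexι_δ_comp K (0 : Fin 2) 1 Y).trans (vertexι_δ_comp K (0 : Fin 2) 2 Y).symm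
  · rw [← h0]
    exact (vertexι_δ_comp K (1 : Fin 2) 1 Y).trans (vertexι_δ_comp K (1 : Fin 2) 0 Y).symm

/-- Composition of a homotopy with the inverse of another one, over a prescribed composition
of their restrictions. -/
lemma exists_homotopy_comp_inv (W : A ⊗ Δ[2] ⟶ X) (c b : K ⊗ Δ[1] ⟶ X)
    (hcb : ι₁ ≫ c = ι₁ ≫ b) (hc : i ▷ _ ≫ c = A ◁ stdSimplex.δ 1 ≫ W)
    (hb : i ▷ _ ≫ b = A ◁ stdSimplex.δ 0 ≫ W) :
    ∃ a : K ⊗ Δ[1] ⟶ X, i ▷ _ ≫ a = A ◁ stdSimplex.δ 2 ≫ W ∧ ι₀ ≫ a = ι₀ ≫ c ∧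
      ι₁ ≫ a = ι₀ ≫ b := by
  -- Now the edges `02` and `12` are given and the filler supplies `01`.
  obtain ⟨Y, h₁, h₂⟩ := exists_tensor_filler i (n := 1) 2 W (fun j _ ↦ if j = 0 then b else c)
    (by
      rw [horn.isCompatible_iff]
      intro j k hj hk hjk
      obtain rfl : j = 0 := by grind
      obtain rfl : k = 1 := by grind
      change stdSimplex.δ 0 ≫ curry b = stdSimplex.δ 0 ≫ curry c
      rw [← curry_natural_left, ← curry_natural_left, whiskerLeft_δ_zero,
        Category.assoc, Category.assoc, hcb])
    (fun j hj ↦ by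
      obtain rfl | rfl : j = 0 ∨ j = 1 := by grind
      · exact hb
      · exact hc)
  have h0 : K ◁ stdSimplex.δ 0 ≫ Y = b := h₂ 0 (by simp)
  have h2 : K ◁ stdSimplex.δ 1 ≫ Y = c := h₂ 1 (by simp)
  refine ⟨K ◁ stdSimplex.δ 2 ≫ Y, ?_, ?_, ?_⟩
  · rw [← whisker_exchange_assoc, h₁]
  · rw [← h2]
    exact (vertexι_δ_comp K (0 : Fin 2) 2 Y).trans (vertexι_δ_comp K (0 : Fin 2) 1 Y).symm
  · rw [← h0]
    exact (vertexι_δ_comp K (1 : Fin 2) 2 Y).trans (vertexι_δ_comp K (0 : Fin 2) 0 Y).symm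

end fill

/-! ### Relative homotopy as an equivalence relation -/

section rel
variable {K X : SSet.{u}} {A : K.Subcomplex} {f g h : K ⟶ X}

lemma HomotopicRel.refl (A : K.Subcomplex) (f : K ⟶ X) : HomotopicRel A f f :=
  ⟨fst _ _ ≫ f, ι₀_fst_assoc _ _, ι₁_fst_assoc _ _, A.ι ≫ f, whiskerRight_fst_assoc _ _ _⟩

variable [KanComplex X]

lemma HomotopicRel.symm (H : HomotopicRel A f g) : HomotopicRel A g f := by
  obtain ⟨H, rfl, rfl, a, ha⟩ := H
  -- The inverse of `H` is the constant homotopy at its end composed with the inverse of `H`.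
  obtain ⟨H', h₁, h₂, h₃⟩ := exists_homotopy_comp_inv A.ι (fst _ _ ≫ a)
    (fst _ _ ≫ ι₁ ≫ H) H (by rw [ι₁_fst_assoc]) (by
      have := ι₁ ≫= ha
      rw [ι₁_comp_assoc, ι₁_fst_assoc] at this
      rw [whiskerLeft_fst_assoc, whiskerRight_fst_assoc, this]) ha
  exact ⟨H', by rw [h₂, ι₀_fst_assoc], h₃, a, h₁⟩

lemma HomotopicRel.trans (H : HomotopicRel A f g) (H' : HomotopicRel A g h) :
    HomotopicRel A f h := by
  obtain ⟨H, rfl, rfl, a, ha⟩ := H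
  obtain ⟨H', h₁, rfl, a', ha'⟩ := H'
  -- Both maps are the restriction to `A` of the common middle map.
  obtain rfl : a = a' := by
    have h₁' := ι₁ ≫= ha
    have h₂' := ι₀ ≫= ha'
    rw [ι₁_comp_assoc, ι₁_fst_assoc] at h₁'
    rw [ι₀_comp_assoc, ι₀_fst_assoc] at h₂'
    rw [← h₁', ← h₂', h₁]
  obtain ⟨H'', h₁, h₂, h₃⟩ := exists_homotopy_comp A.ι (fst _ _ ≫ a) H H' h₁.symm ha ha'
  exact ⟨H'', h₂, h₃, a, h₁⟩

end rel

/-- The factoring map `a` is determined by the homotopy at time `0`, so nothing is lost by leaving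
it unspecified. -/
lemma nonempty_homotopy_iff {K X : SSet.{u}} {A : K.Subcomplex} {B : X.Subcomplex}
    {φ : (A : SSet) ⟶ (B : SSet)} (f g : RelativeMorphism A B φ) :
    Nonempty (f.Homotopy g) ↔ HomotopicRel A f.map g.map := by
  refine ⟨fun ⟨H⟩ ↦ ⟨H.h, H.h₀, H.h₁, _, H.rel⟩, fun ⟨H, h₀, h₁, a, ha⟩ ↦ ⟨H, h₀, h₁, ?_⟩⟩
  have := ι₀ ≫= ha
  rw [ι₀_comp_assoc, ι₀_fst_assoc, h₀, f.comm] at this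
  rw [ha, this]

lemma equivalence_homotopy {K X : SSet.{u}} [KanComplex X] {A : K.Subcomplex} {B : X.Subcomplex}
    {φ : (A : SSet) ⟶ (B : SSet)} :
    Equivalence fun f g : RelativeMorphism A B φ ↦ Nonempty (f.Homotopy g) := by
  simp only [nonempty_homotopy_iff]
  exact ⟨fun _ ↦ .refl _ _, .symm, .trans⟩

/-! ### The boundary as a face glued to a horn -/

/-- The inclusion of the boundary of a face in the horn missing that face. -/
noncomputable def boundaryToHorn {n : ℕ} (k : Fin (n + 2)) : (∂Δ[n] : SSet.{u}) ⟶ Λ[n + 1, k] :=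
  Subcomplex.lift (∂Δ[n].ι ≫ stdSimplex.δ k) (by
    rintro ⟨⟨m⟩⟩ _ ⟨⟨x, hx⟩, rfl⟩
    erw [mem_horn_iff_notMem_range]
    rw [mem_boundary_iff_notMem_range] at hx
    obtain ⟨j, hj⟩ := hx
    refine ⟨k.succAbove j, k.succAbove_ne j, ?_⟩
    rintro ⟨l, hl⟩
    exact hj ⟨l, Fin.succAbove_right_injective hl⟩)

lemma horn_le_boundary {n : ℕ} (k : Fin (n + 1)) :
    Λ[n, k] ≤ (∂Δ[n] : (Δ[n] : SSet.{u}).Subcomplex) := by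
  rw [horn_eq_iSup, boundary_eq_iSup]
  exact iSup_le fun j ↦ le_iSup (fun j ↦ stdSimplex.face.{u} {j}ᶜ) j.1

/-- The inclusion of a horn in the boundary. -/
noncomputable abbrev hornToBoundary {n : ℕ} (k : Fin (n + 1)) : (Λ[n, k] : SSet.{u}) ⟶ ∂Δ[n] :=
  Subcomplex.homOfLE (horn_le_boundary k)

/-- The face and the complementary horn cover the boundary and meet exactly in the boundary of the
face. -/
lemma isPushout_boundary {n : ℕ} (k : Fin (n + 2)) :
    IsPushout (∂Δ[n].ι) (boundaryToHorn.{u} k) (boundary.ι k) (hornToBoundary k) := by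
  have sq : Subcomplex.BicartSq (Subcomplex.range (∂Δ[n].ι ≫ stdSimplex.δ.{u} k))
      (Subcomplex.range (stdSimplex.δ.{u} k)) Λ[n + 1, k] ∂Δ[n + 1] :=
    { sup_eq := by
        rw [stdSimplex.range_δ, horn_eq_iSup, boundary_eq_iSup]
        refine le_antisymm (sup_le (le_iSup (fun j ↦ stdSimplex.face.{u} {j}ᶜ) k)
          (iSup_le fun j ↦ le_iSup (fun j ↦ stdSimplex.face.{u} {j}ᶜ) j.1)) (iSup_le fun j ↦ ?_)
        by_cases hj : j = k
        · subst hj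
          exact le_sup_left
        · exact le_sup_of_le_right
            (le_iSup (fun j : ({k}ᶜ : Set (Fin (n + 2))) ↦ stdSimplex.face.{u} {j.1}ᶜ) ⟨j, hj⟩)
      inf_eq := by
        refine le_antisymm ?_ (le_inf ?_ ?_)
        · rintro ⟨⟨m⟩⟩ _ ⟨⟨x, rfl⟩, hx⟩
          refine ⟨⟨x, ?_⟩, rfl⟩
          erw [mem_horn_iff_notMem_range] at hx
          obtain ⟨j, hjk, hj⟩ := hx
          obtain ⟨j, rfl⟩ := Fin.exists_succAbove_eq hjk
          erw [mem_boundary_iff_notMem_range]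
          refine ⟨j, ?_⟩
          rintro ⟨l, rfl⟩
          exact hj ⟨l, rfl⟩
        · rw [Subcomplex.range_comp]
          exact Subcomplex.image_le_range _ _
        · rintro m _ ⟨x, rfl⟩
          exact ((boundaryToHorn k).app m x).2 }
  exact sq.isPushout.of_iso' (asIso (Subcomplex.toRange (∂Δ[n].ι ≫ stdSimplex.δ.{u} k)))
    (asIso (Subcomplex.toRange (stdSimplex.δ.{u} k))) (Iso.refl _) (Iso.refl _) rfl rfl rfl rfl

lemma isPushout_boundary_tensor {n : ℕ} (k : Fin (n + 2)) (Z : SSet.{u}) :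
    IsPushout (∂Δ[n].ι ▷ Z) (boundaryToHorn.{u} k ▷ Z) (boundary.ι k ▷ Z) (hornToBoundary k ▷ Z) :=
  (isPushout_boundary k).map (tensorRight Z)

/-! ### Simplex homotopies and prisms -/

/-- The map `Δ[n] ⊗ Δ[1] ⟶ Δ[m]` induced by a monotone map on vertices. -/
def prismMap {n m : ℕ} (φ : Fin (n + 1) × Fin 2 →o Fin (m + 1)) :
    (Δ[n] ⊗ Δ[1] : SSet.{u}) ⟶ Δ[m] where
  app _ := ↾fun z ↦ stdSimplex.objMk
    (φ.comp ((stdSimplex.asOrderHom z.1).prod (stdSimplex.asOrderHom z.2)))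
  naturality _ _ _ := rfl

lemma stdSimplex_hom_ext {K : SSet.{u}} {m : ℕ} {f g : K ⟶ Δ[m]}
    (h : ∀ (d : ℕ) (x : K _⦋d⦌) (j : Fin (d + 1)),
      (f.app _ x : Δ[m] _⦋d⦌) j = (g.app _ x : Δ[m] _⦋d⦌) j) : f = g := by
  ext ⟨⟨d⟩⟩ : 1
  apply ConcreteCategory.hom_ext
  intro x
  exact SSet.stdSimplex.ext _ _ (h d x)

/-- Collapsing the prism over `Δ[n]` onto its last top-dimensional simplex. -/
def lastPrism (n : ℕ) : Fin (n + 1) × Fin 2 →o Fin (n + 2) where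
  toFun p := if p.1 = Fin.last n ∧ p.2 = 1 then Fin.last _ else p.1.castSucc
  monotone' := by
    rintro ⟨a, e⟩ ⟨b, e'⟩ ⟨h₁, h₂⟩
    dsimp at h₁ h₂ ⊢
    split_ifs <;> grind

lemma lastPrism_apply {n : ℕ} (a : Fin (n + 1)) (e : Fin 2) :
    lastPrism n (a, e) = if a = Fin.last n ∧ e = 1 then Fin.last _ else a.castSucc := rfl

lemma ι₀_prismMap_lastPrism (n : ℕ) :
    ι₀ ≫ prismMap.{u} (lastPrism n) = stdSimplex.δ (Fin.last (n + 1)) := by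
  refine stdSimplex_hom_ext fun d x j ↦ ?_
  change (lastPrism n) ((x : Δ[n] _⦋d⦌) j, 0) = (Fin.last (n + 1)).succAbove ((x : Δ[n] _⦋d⦌) j)
  simp [lastPrism_apply]

lemma ι₁_prismMap_lastPrism (n : ℕ) :
    ι₁ ≫ prismMap.{u} (lastPrism n) = stdSimplex.δ (Fin.last n).castSucc := by
  refine stdSimplex_hom_ext fun d x j ↦ ?_
  change (lastPrism n) ((x : Δ[n] _⦋d⦌) j, 1) = (Fin.last n).castSucc.succAbove ((x : Δ[n] _⦋d⦌) j)
  generalize (x : Δ[n] _⦋d⦌) j = a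
  simp only [lastPrism_apply, Fin.succAbove]
  split_ifs <;> grind

/-- This makes the homotopy constant over those faces where the filling simplex is a last
degeneracy. -/
lemma prismMap_lastPrism_σ (n : ℕ) :
    prismMap.{u} (lastPrism n) ≫ stdSimplex.σ (Fin.last n) = fst _ _ := by
  refine stdSimplex_hom_ext fun d ⟨x, y⟩ j ↦ ?_
  change (Fin.last n).predAbove ((lastPrism n) ((x : Δ[n] _⦋d⦌) j, (y : Δ[1] _⦋d⦌) j)) =
    (x : Δ[n] _⦋d⦌) j
  generalize (x : Δ[n] _⦋d⦌) j = a
  simp only [lastPrism_apply, Fin.predAbove]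
  split_ifs <;> first | grind | simp

lemma δ_prismMap_lastPrism {n : ℕ} (i : Fin (n + 1)) :
    stdSimplex.δ i.castSucc ▷ Δ[1] ≫ prismMap.{u} (lastPrism (n + 1)) =
      prismMap (lastPrism n) ≫ stdSimplex.δ i.castSucc.castSucc := by
  refine stdSimplex_hom_ext fun d ⟨x, y⟩ j ↦ ?_
  change (lastPrism (n + 1)) (i.castSucc.succAbove ((x : Δ[n] _⦋d⦌) j), (y : Δ[1] _⦋d⦌) j) =
    i.castSucc.castSucc.succAbove ((lastPrism n) ((x : Δ[n] _⦋d⦌) j, (y : Δ[1] _⦋d⦌) j))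
  generalize (x : Δ[n] _⦋d⦌) j = a
  simp only [lastPrism_apply, Fin.succAbove]
  split_ifs <;> grind

/-- Time matters only at the last vertex, which this face omits. -/
lemma δ_last_prismMap_lastPrism (n : ℕ) :
    stdSimplex.δ (Fin.last (n + 1)) ▷ Δ[1] ≫ prismMap.{u} (lastPrism (n + 1)) =
      fst _ _ ≫ stdSimplex.δ (Fin.last (n + 1)) ≫ stdSimplex.δ (Fin.last (n + 2)) := by
  refine stdSimplex_hom_ext fun d ⟨x, y⟩ j ↦ ?_
  change (lastPrism (n + 1)) ((Fin.last _).succAbove ((x : Δ[n] _⦋d⦌) j), (y : Δ[1] _⦋d⦌) j) =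
    (Fin.last _).succAbove ((Fin.last _).succAbove ((x : Δ[n] _⦋d⦌) j))
  generalize (x : Δ[n] _⦋d⦌) j = a
  simp only [lastPrism_apply, Fin.succAbove]
  split_ifs <;> grind

lemma boundary_whiskerRight_hom_ext {n : ℕ} {Z X : SSet.{u}}
    {f g : (∂Δ[n + 1] : SSet.{u}) ⊗ Z ⟶ X}
    (h : ∀ i, boundary.ι i ▷ Z ≫ f = boundary.ι i ▷ Z ≫ g) : f = g := by
  ext m ⟨⟨x, hx⟩, z⟩
  simp only [boundary_eq_iSup, stdSimplex.face_singleton_compl, Subfunctor.iSup_obj,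
    Set.mem_iUnion, Subcomplex.mem_ofSimplex_obj_iff, op_unop] at hx
  obtain ⟨i, ⟨y, rfl⟩⟩ := hx
  exact ConcreteCategory.congr_hom (congr_app (h i) _) (⟨_, z⟩ : _ × _)

lemma SimplexHomotopic.homotopicRel {X : SSet.{u}} {n : ℕ} {x x' : X _⦋n + 1⦌}
    (h : SimplexHomotopic x x') :
    HomotopicRel ∂Δ[n + 1] (yonedaEquiv.symm x') (yonedaEquiv.symm x) := by
  obtain ⟨hx, y, h₀, h₁, h₂⟩ := h
  -- Time `0` lands on the last face, so the homotopy runs from `x'` to `x`.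
  refine ⟨prismMap (lastPrism (n + 1)) ≫ yonedaEquiv.symm y, ?_, ?_,
    ∂Δ[n + 1].ι ≫ yonedaEquiv.symm x, boundary_whiskerRight_hom_ext fun i ↦ ?_⟩
  · rw [← Category.assoc, ι₀_prismMap_lastPrism, stdSimplex.δ_comp_yonedaEquiv_symm, h₁]
  · rw [← Category.assoc, ι₁_prismMap_lastPrism, stdSimplex.δ_comp_yonedaEquiv_symm, h₀]
  · rw [whiskerRight_fst_assoc, boundary.ι_ι_assoc, ← comp_whiskerRight_assoc, boundary.ι_ι]
    obtain ⟨i, rfl⟩ | rfl := i.eq_castSucc_or_eq_last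
    · rw [← Category.assoc, δ_prismMap_lastPrism, Category.assoc,
        stdSimplex.δ_comp_yonedaEquiv_symm, h₂, ← stdSimplex.σ_comp_yonedaEquiv_symm,
        ← Category.assoc, prismMap_lastPrism_σ, stdSimplex.δ_comp_yonedaEquiv_symm]
    · rw [← Category.assoc, δ_last_prismMap_lastPrism, Category.assoc, Category.assoc,
        stdSimplex.δ_comp_yonedaEquiv_symm, h₁, stdSimplex.δ_comp_yonedaEquiv_symm, ← hx,
        ← stdSimplex.δ_comp_yonedaEquiv_symm]

/-- Gluing a homotopy on a face with the constant homotopy on the complementary horn. -/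
lemma exists_boundary_homotopy {X : SSet.{u}} {n : ℕ} (k : Fin (n + 2)) (H : Δ[n] ⊗ Δ[1] ⟶ X)
    (v : (Λ[n + 1, k] : SSet.{u}) ⟶ X)
    (hv : ∂Δ[n].ι ▷ Δ[1] ≫ H = fst _ _ ≫ boundaryToHorn k ≫ v) :
    ∃ G : (∂Δ[n + 1] : SSet.{u}) ⊗ Δ[1] ⟶ X, boundary.ι k ▷ Δ[1] ≫ G = H ∧
      hornToBoundary k ▷ Δ[1] ≫ G = fst _ _ ≫ v := by
  have w : ∂Δ[n].ι ▷ Δ[1] ≫ H = boundaryToHorn k ▷ Δ[1] ≫ fst _ _ ≫ v := by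
    rw [hv, whiskerRight_fst_assoc]
  exact ⟨(isPushout_boundary_tensor k Δ[1]).desc H (fst _ _ ≫ v) w,
    (isPushout_boundary_tensor k Δ[1]).inl_desc _ _ w,
    (isPushout_boundary_tensor k Δ[1]).inr_desc _ _ w⟩

lemma horn_ι_hornToBoundary {n : ℕ} (k j : Fin (n + 2)) (h : j ≠ k) :
    horn.ι.{u} k j h ≫ hornToBoundary k = boundary.ι j := by
  rw [← cancel_mono (Subcomplex.ι _), Category.assoc, Subcomplex.homOfLE_ι, horn.ι_ι,
    boundary.ι_ι]

lemma boundaryToHorn_ι {n : ℕ} (k : Fin (n + 2)) :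
    boundaryToHorn.{u} k ≫ Λ[n + 1, k].ι = ∂Δ[n].ι ≫ stdSimplex.δ k := rfl

lemma homotopicRel_left {K X : SSet.{u}} {A : K.Subcomplex} {f g : K ⟶ X}
    (h : HomotopicRel A f g) : ∃ H : K ⊗ Δ[1] ⟶ X, ι₀ ≫ H = f ∧ ι₁ ≫ H = g ∧
      A.ι ▷ Δ[1] ≫ H = fst _ _ ≫ A.ι ≫ f := by
  obtain ⟨H, h₀, h₁, a, ha⟩ := h
  have := ι₀ ≫= ha
  rw [ι₀_comp_assoc, ι₀_fst_assoc, h₀] at this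
  exact ⟨H, h₀, h₁, by rw [ha, this]⟩

lemma HomotopicRel.ι_comp_eq {K X : SSet.{u}} {A : K.Subcomplex} {f g : K ⟶ X}
    (h : HomotopicRel A f g) : A.ι ≫ f = A.ι ≫ g := by
  obtain ⟨H, h₀, h₁, h₂⟩ := homotopicRel_left h
  have := ι₁ ≫= h₂
  rw [ι₁_comp_assoc, ι₁_fst_assoc, h₁] at this
  exact this.symm

lemma HomotopicRel.simplexHomotopic {X : SSet.{u}} [KanComplex X] {n : ℕ} {x x' : X _⦋n + 1⦌}
    (h : HomotopicRel ∂Δ[n + 1] (yonedaEquiv.symm x') (yonedaEquiv.symm x)) :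
    SimplexHomotopic x x' := by
  have hδ (i : Fin (n + 2)) : X.δ i x = X.δ i x' := by
    have := boundary.ι i ≫= h.ι_comp_eq
    rw [boundary.ι_ι_assoc, boundary.ι_ι_assoc, stdSimplex.δ_comp_yonedaEquiv_symm,
      stdSimplex.δ_comp_yonedaEquiv_symm] at this
    exact (yonedaEquiv.symm.injective this).symm
  obtain ⟨H, h₀, h₁, h₂⟩ := homotopicRel_left h
  let k : Fin (n + 3) := (Fin.last (n + 1)).castSucc
  -- Both of the last two faces of `s` are `x'`. Moving face `k` along `H`, keeping the others fixed
  -- and extending over the simplex gives the required `y` at time `1`.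
  let s : Δ[n + 2] ⟶ X := stdSimplex.σ (Fin.last (n + 1)) ≫ yonedaEquiv.symm x'
  have hs : stdSimplex.δ k ≫ s = yonedaEquiv.symm x' :=
    CosimplicialObject.δ_comp_σ_self_assoc _ _
  obtain ⟨G, hG₁, hG₂⟩ := exists_boundary_homotopy k H (Λ[n + 2, k].ι ≫ s) (by
    rw [h₂, ← Category.assoc (boundaryToHorn k), boundaryToHorn_ι, Category.assoc, hs])
  obtain ⟨Y, hY₁, hY₂⟩ := exists_homotopy_extension_ι₀ ∂Δ[n + 2].ι G s
    ((isPushout_boundary k).hom_ext (by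
      rw [← ι₀_comp_assoc, hG₁, h₀, boundary.ι_ι_assoc, hs]) (by
      rw [← ι₀_comp_assoc, hG₂, ι₀_fst_assoc, ← Category.assoc, Subcomplex.homOfLE_ι]))
  have hf (j : Fin (n + 3)) : stdSimplex.δ j ≫ ι₁ ≫ Y = boundary.ι j ≫ ι₁ ≫ G := by
    rw [← hY₁, ι₁_comp_assoc, boundary.ι_ι_assoc]
  have hne (j : Fin (n + 3)) (hj : j ≠ k) : stdSimplex.δ j ≫ ι₁ ≫ Y = stdSimplex.δ j ≫ s := by
    rw [hf, ← horn_ι_hornToBoundary k j hj, Category.assoc, ← ι₁_comp_assoc, hG₂, ι₁_fst_assoc,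
      horn.ι_ι_assoc]
  refine ⟨hδ, yonedaEquiv (ι₁ ≫ Y), ?_, ?_, fun i ↦ ?_⟩
  · rw [← stdSimplex.yonedaEquiv_δ_comp, hf, ← ι₁_comp_assoc, hG₁, h₁, Equiv.apply_symm_apply]
  · rw [← stdSimplex.yonedaEquiv_δ_comp, hne _ (by simp [k, Fin.ext_iff])]
    dsimp only [s]
    rw [← Fin.succ_last, CosimplicialObject.δ_comp_σ_succ_assoc, Equiv.apply_symm_apply]
  · rw [← stdSimplex.yonedaEquiv_δ_comp, hne _ (by simp [k, Fin.ext_iff]; omega)]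
    dsimp only [s]
    rw [← Fin.succ_last n, stdSimplex.δ_comp_σ_of_le_assoc (by grind),
      stdSimplex.δ_comp_yonedaEquiv_symm, stdSimplex.σ_comp_yonedaEquiv_symm,
      Equiv.apply_symm_apply, hδ]

lemma simplexHomotopic_iff {X : SSet.{u}} [KanComplex X] {n : ℕ} (x x' : X _⦋n + 1⦌) :
    SimplexHomotopic x x' ↔
      HomotopicRel ∂Δ[n + 1] (yonedaEquiv.symm x) (yonedaEquiv.symm x') :=
  ⟨fun h ↦ h.homotopicRel.symm, fun h ↦ h.symm.simplexHomotopic⟩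

/-! ### Spherical simplices as maps of pairs -/

lemma δ_mem_basepoint_iff {X : SSet.{u}} (pt : X _⦋0⦌) {n : ℕ} (x : X _⦋n + 1⦌) (i : Fin (n + 2)) :
    X.δ i x ∈ (basepoint pt).obj (op ⦋n⦌) ↔
      stdSimplex.δ i ≫ yonedaEquiv.symm x = SSet.const pt := by
  have hpt : yonedaEquiv (SSet.const (X := Δ[n]) pt) =
      X.map (SimplexCategory.const ⦋n⦌ ⦋0⦌ 0).op pt := rfl
  rw [stdSimplex.δ_comp_yonedaEquiv_symm, Equiv.symm_apply_eq, Subcomplex.mem_ofSimplex_obj_iff]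
  erw [hpt]
  constructor
  · rintro ⟨f, hf⟩
    rw [← hf]
    congr
    ext
    simp
  · intro h
    exact ⟨_, h.symm⟩

/-- Spherical simplices are represented by maps of pairs. -/
noncomputable def sphericalSimplexEquiv {X : SSet.{u}} (pt : X _⦋0⦌) (n : ℕ) :
    SphericalSimplex pt n ≃ X.PtSimplex (n + 1) pt where
  toFun x :=
    { map := yonedaEquiv.symm x.1
      comm := boundary.hom_ext fun i ↦ by
        rw [boundary.ι_ι_assoc, (δ_mem_basepoint_iff pt x.1 i).1 (x.2 i)]
        rfl }
  invFun g := ⟨yonedaEquiv g.map, fun i ↦ by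
    rw [δ_mem_basepoint_iff, Equiv.symm_apply_apply, PtSimplex.δ_map]⟩
  left_inv x := Subtype.ext (by simp)
  right_inv g := RelativeMorphism.ext (by simp)

lemma sphericalSimplexEquiv_apply_eq_iff {X : SSet.{u}} {pt : X _⦋0⦌} {n : ℕ}
    (x : SphericalSimplex pt n) (g : X.PtSimplex (n + 1) pt) :
    yonedaEquiv g.map = x.1 ↔ g = sphericalSimplexEquiv pt n x := by
  exact Subtype.ext_iff.symm.trans (sphericalSimplexEquiv pt n).symm_apply_eq

lemma simplexHomotopic_iff_nonempty_homotopy {X : SSet.{u}} [KanComplex X] {pt : X _⦋0⦌} {n : ℕ}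
    (x x' : SphericalSimplex pt n) :
    SimplexHomotopic x.1 x'.1 ↔ Nonempty ((sphericalSimplexEquiv pt n x).Homotopy
      (sphericalSimplexEquiv pt n x')) := by
  rw [simplexHomotopic_iff, nonempty_homotopy_iff]
  rfl

/-! ### Contraction of the horn -/

/-- The contraction of the vertices of a simplex to the initial one. -/
def contraction (m : ℕ) : Fin (m + 1) × Fin 2 →o Fin (m + 1) where
  toFun p := if p.2 = 0 then 0 else p.1
  monotone' := by
    rintro ⟨a, e⟩ ⟨b, e'⟩ ⟨h₁, h₂⟩
    dsimp at h₁ h₂ ⊢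
    split_ifs <;> grind

lemma contraction_apply {m : ℕ} (a : Fin (m + 1)) (e : Fin 2) :
    contraction m (a, e) = if e = 0 then 0 else a := rfl

/-- The contraction of the horn `Λ[m, 0]` onto its initial vertex. -/
def hornContraction (m : ℕ) : (Λ[m, 0] : SSet.{u}) ⊗ Δ[1] ⟶ Λ[m, 0] :=
  Subcomplex.lift (Λ[m, 0].ι ▷ Δ[1] ≫ prismMap (contraction m)) (by
    rintro ⟨⟨d⟩⟩ _ ⟨⟨⟨x, hx⟩, y⟩, rfl⟩
    erw [mem_horn_iff_notMem_range] at hx ⊢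
    obtain ⟨j, hj₀, hj⟩ := hx
    refine ⟨j, hj₀, ?_⟩
    rintro ⟨l, hl⟩
    change contraction m ((x : Δ[m] _⦋d⦌) l, (y : Δ[1] _⦋d⦌) l) = j at hl
    rw [contraction_apply] at hl
    split_ifs at hl
    · exact hj₀ hl.symm
    · exact hj ⟨l, hl⟩)

/-- The initial vertex of a horn. -/
def hornVertex (m : ℕ) : (Λ[m + 2, 0] : SSet.{u}) _⦋0⦌ :=
  ⟨stdSimplex.obj₀Equiv.symm 0, by simp⟩

lemma ι₁_hornContraction (m : ℕ) : ι₁ ≫ hornContraction.{u} m = 𝟙 _ := by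
  rw [← cancel_mono (Subcomplex.ι _)]
  refine stdSimplex_hom_ext fun d x j ↦ ?_
  change contraction m ((x.1 : Δ[m] _⦋d⦌) j, 1) = (x.1 : Δ[m] _⦋d⦌) j
  simp [contraction_apply]

lemma ι₀_hornContraction (m : ℕ) :
    ι₀ ≫ hornContraction.{u} (m + 2) = SSet.const (hornVertex m) := by
  rw [← cancel_mono (Subcomplex.ι _)]
  refine stdSimplex_hom_ext fun d x j ↦ ?_
  change contraction (m + 2) ((x.1 : Δ[m + 2] _⦋d⦌) j, 0) = 0
  simp [contraction_apply]

/-- The contraction fixes the vertex at all times, so homotopies built from it are relative to the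
basepoint. -/
lemma const_hornVertex_hornContraction (m : ℕ) (K : SSet.{u}) :
    (SSet.const (hornVertex m) : K ⟶ _) ▷ Δ[1] ≫ hornContraction.{u} (m + 2) =
      SSet.const (hornVertex m) := by
  rw [← cancel_mono (Subcomplex.ι _)]
  refine stdSimplex_hom_ext fun d ⟨x, y⟩ j ↦ ?_
  change contraction (m + 2) (0, (y : Δ[1] _⦋d⦌) j) = 0
  simp [contraction_apply]

lemma const_hornVertex_hornToBoundary (n : ℕ) (K : SSet.{u}) :
    (SSet.const (hornVertex n) : K ⟶ _) ≫ hornToBoundary 0 = SSet.const (vertexZero n) := rfl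

lemma basepoint_ι (n : ℕ) : (basepoint (vertexZero.{u} n)).ι =
    SSet.const (hornVertex n) ≫ hornToBoundary 0 := by
  rw [const_hornVertex_hornToBoundary, Subcomplex.ofSimplex_ι]

/-! ### From disks to spheres: existence, homotopy invariance, surjectivity -/

section
variable {X : SSet.{u}} {pt : X _⦋0⦌} {n : ℕ}

lemma hornToBoundary_comp_eq_const_iff (f : (∂Δ[n + 1] : SSet.{u}) ⟶ X) (k : Fin (n + 2)) :
    hornToBoundary k ≫ f = SSet.const pt ↔
      ∀ i, i ≠ k → boundary.ι i ≫ f = SSet.const pt := by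
  constructor
  · intro h i hi
    rw [← horn_ι_hornToBoundary k i hi, Category.assoc, h]
    rfl
  · intro h
    refine horn.hom_ext' fun j hj ↦ ?_
    rw [← Category.assoc, horn_ι_hornToBoundary, h j hj]
    rfl

lemma isCollapseExtension_iff (g : X.PtSimplex (n + 1) pt) (f : PointedSphere pt n) :
    IsCollapseExtension g f ↔
      boundary.ι 0 ≫ f.map = g.map ∧ hornToBoundary 0 ≫ f.map = SSet.const pt := by
  rw [hornToBoundary_comp_eq_const_iff]
  rfl

lemma app_vertexZero_of_hornToBoundary_comp {f : (∂Δ[n + 2] : SSet.{u}) ⟶ X}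
    (h : hornToBoundary 0 ≫ f = SSet.const pt) : f.app _ (vertexZero n) = pt := by
  have := ConcreteCategory.congr_hom (congr_app h (op ⦋0⦌)) (hornVertex n)
  refine this.trans ?_
  simp

/-- The pointed sphere attached to a map which is constant on the horn. -/
def PointedSphere.ofHornToBoundary (f : (∂Δ[n + 2] : SSet.{u}) ⟶ X)
    (h : hornToBoundary 0 ≫ f = SSet.const pt) : PointedSphere pt n :=
  RelativeMorphism.ofSimplex₀ f _ _ (app_vertexZero_of_hornToBoundary_comp h)

lemma existsUnique_isCollapseExtension (g : X.PtSimplex (n + 1) pt) :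
    ∃! f : PointedSphere pt n, IsCollapseExtension g f := by
  have w : ∂Δ[n + 1].ι ≫ g.map = boundaryToHorn 0 ≫ SSet.const pt := by
    rw [g.comm]
    rfl
  refine ⟨.ofHornToBoundary ((isPushout_boundary 0).desc g.map (SSet.const pt) w)
    ((isPushout_boundary 0).inr_desc _ _ w), ?_, fun f hf ↦ ?_⟩
  · exact (isCollapseExtension_iff _ _).2
      ⟨(isPushout_boundary 0).inl_desc _ _ w, (isPushout_boundary 0).inr_desc _ _ w⟩
  · replace hf := (isCollapseExtension_iff _ _).1 hf
    refine RelativeMorphism.ext ((isPushout_boundary 0).hom_ext ?_ ?_)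
    · exact hf.1.trans ((isPushout_boundary 0).inl_desc _ _ w).symm
    · exact hf.2.trans ((isPushout_boundary 0).inr_desc _ _ w).symm

/-- The extension of a map on a face to the sphere, constant on the other faces. -/
noncomputable def collapseExtension (g : X.PtSimplex (n + 1) pt) : PointedSphere pt n :=
  (existsUnique_isCollapseExtension g).choose

lemma isCollapseExtension_collapseExtension (g : X.PtSimplex (n + 1) pt) :
    IsCollapseExtension g (collapseExtension g) :=
  (existsUnique_isCollapseExtension g).choose_spec.1

lemma IsCollapseExtension.homotopy {g g' : X.PtSimplex (n + 1) pt} {f f' : PointedSphere pt n}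
    (hf : IsCollapseExtension g f) (hf' : IsCollapseExtension g' f')
    (h : Nonempty (g.Homotopy g')) : Nonempty (f.Homotopy f') := by
  rw [isCollapseExtension_iff] at hf hf'
  obtain ⟨H⟩ := h
  -- The glued homotopy is constant on the horn, which contains `[0]`; hence it is relative to the
  -- basepoint.
  obtain ⟨G, hG₁, hG₂⟩ := exists_boundary_homotopy 0 H.h (SSet.const pt) (by rw [H.rel]; rfl)
  rw [nonempty_homotopy_iff]
  refine ⟨G, (isPushout_boundary 0).hom_ext ?_ ?_, (isPushout_boundary 0).hom_ext ?_ ?_,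
    SSet.const pt, ?_⟩
  · rw [← ι₀_comp_assoc, hG₁, H.h₀, hf.1]
  · rw [← ι₀_comp_assoc, hG₂, ι₀_fst_assoc, hf.2]
  · rw [← ι₁_comp_assoc, hG₁, H.h₁, hf'.1]
  · rw [← ι₁_comp_assoc, hG₂, ι₁_fst_assoc, hf'.2]
  · rw [basepoint_ι, comp_whiskerRight, Category.assoc, hG₂, whiskerRight_fst_assoc]
    rfl

lemma const_comp_app_vertexZero (f : PointedSphere pt n) (K : SSet.{u}) :
    (SSet.const (hornVertex n) : K ⟶ _) ≫ hornToBoundary 0 ≫ f.map = SSet.const pt := by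
  have h : f.map.app _ (vertexZero n) = pt :=
    (f.map_eq_of_mem _ (Subcomplex.mem_ofSimplex_obj _)).trans (by
      change X.map _ pt = pt
      simp)
  rw [← Category.assoc, const_hornVertex_hornToBoundary, const_comp, h]

variable [KanComplex X]

lemma exists_isCollapseExtension_homotopy (f : PointedSphere pt n) :
    ∃ (g : X.PtSimplex (n + 1) pt) (f' : PointedSphere pt n), IsCollapseExtension g f' ∧
      Nonempty (f'.Homotopy f) := by
  -- The contraction is the identity at time `1`, so `f` is prescribed there; at time `0` the whole
  -- horn goes to the basepoint.
  obtain ⟨Y, hY₁, hY₂⟩ := exists_homotopy_extension_ι₁ (hornToBoundary 0)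
    (hornContraction (n + 2) ≫ hornToBoundary 0 ≫ f.map) f.map (by
      rw [← Category.assoc ι₁, ι₁_hornContraction, Category.id_comp])
  have h₀ : hornToBoundary 0 ≫ ι₀ ≫ Y = SSet.const pt := by
    rw [← ι₀_comp_assoc, hY₁, ← Category.assoc ι₀, ι₀_hornContraction, const_comp_app_vertexZero]
  let g : X.PtSimplex (n + 1) pt :=
    { map := boundary.ι 0 ≫ ι₀ ≫ Y
      comm := by
        rw [(isPushout_boundary 0).w_assoc, h₀]
        rfl }
  refine ⟨g, .ofHornToBoundary (ι₀ ≫ Y) h₀, ?_, ?_⟩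
  · rw [isCollapseExtension_iff]
    exact ⟨rfl, h₀⟩
  · rw [nonempty_homotopy_iff]
    refine ⟨Y, rfl, hY₂, SSet.const pt, ?_⟩
    rw [basepoint_ι, comp_whiskerRight, Category.assoc, hY₁, ← Category.assoc,
      const_hornVertex_hornContraction, const_comp_app_vertexZero]
    rfl

end

/-! ### From spheres back to disks: injectivity -/

/-- Moving a point of the horn along the contraction at time `s`, keeping the time `t`. -/
noncomputable def contractionAlong {m n : ℕ} (t s : Δ[n] ⟶ Δ[1]) :
    (Λ[m, 0] : SSet.{u}) ⊗ Δ[n] ⟶ Λ[m, 0] ⊗ Δ[1] :=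
  lift ((Λ[m, 0] : SSet.{u}) ◁ s ≫ hornContraction m) (snd _ _ ≫ t)

lemma whiskerLeft_contractionAlong {m n k : ℕ} (θ : Δ[k] ⟶ Δ[n]) (t s : Δ[n] ⟶ Δ[1]) :
    (Λ[m, 0] : SSet.{u}) ◁ θ ≫ contractionAlong t s = contractionAlong (θ ≫ t) (θ ≫ s) := by
  simp [contractionAlong]

lemma whiskerLeft_const {K L : SSet.{u}} (v : L _⦋0⦌) (Z : SSet.{u}) :
    K ◁ (SSet.const v : Z ⟶ L) = fst _ _ ≫ lift (𝟙 K) (SSet.const v) := by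
  simp only [comp_lift, Category.comp_id]
  rfl

/-- This and the next three lemmas compute the sides of the square with coordinates `(t, s)`. -/
lemma contractionAlong_const_one {m n : ℕ} (t : Δ[n] ⟶ Δ[1]) :
    contractionAlong t (SSet.const (stdSimplex.obj₀Equiv.symm 1)) = (Λ[m, 0] : SSet.{u}) ◁ t := by
  rw [contractionAlong, whiskerLeft_const]
  change lift ((fst _ _ ≫ ι₁) ≫ _) _ = _
  rw [Category.assoc, ι₁_hornContraction]
  ext1 <;> simp

lemma const_zero_contractionAlong {m n : ℕ} (s : Δ[n] ⟶ Δ[1]) :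
    contractionAlong (SSet.const (stdSimplex.obj₀Equiv.symm 0)) s =
      (Λ[m, 0] : SSet.{u}) ◁ s ≫ hornContraction m ≫ ι₀ := by
  rw [ι₀, comp_lift, comp_lift, contractionAlong]
  simp

lemma const_one_contractionAlong {m n : ℕ} (s : Δ[n] ⟶ Δ[1]) :
    contractionAlong (SSet.const (stdSimplex.obj₀Equiv.symm 1)) s =
      (Λ[m, 0] : SSet.{u}) ◁ s ≫ hornContraction m ≫ ι₁ := by
  rw [ι₁, comp_lift, comp_lift, contractionAlong]
  simp

lemma contractionAlong_const_zero {m n : ℕ} (t : Δ[n] ⟶ Δ[1]) :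
    contractionAlong t (SSet.const (stdSimplex.obj₀Equiv.symm 0)) =
      (SSet.const (hornVertex m) : (Λ[m + 2, 0] : SSet.{u}) ⟶ _) ▷ Δ[n] ≫ _ ◁ t := by
  rw [contractionAlong, whiskerLeft_const]
  change lift ((fst _ _ ≫ ι₀) ≫ _) _ = _
  rw [Category.assoc, ι₀_hornContraction]
  ext1 <;> simp

section
variable {X : SSet.{u}} [KanComplex X] {pt : X _⦋0⦌} {n : ℕ}

/-- On the horn, `F` fills the side `s = 1` of the `(t, s)`-square, whose other three sides are
constant at `pt`. Crossing its two triangles replaces that side first by the diagonal and then by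
the side `s = 0`. -/
lemma exists_homotopy_const_on_horn {f f' : PointedSphere pt n}
    (hf : hornToBoundary 0 ≫ f.map = SSet.const pt)
    (hf' : hornToBoundary 0 ≫ f'.map = SSet.const pt) (F : f.Homotopy f') :
    ∃ G : (∂Δ[n + 2] : SSet.{u}) ⊗ Δ[1] ⟶ X, hornToBoundary 0 ▷ Δ[1] ≫ G = SSet.const pt ∧
      ι₀ ≫ G = f.map ∧ ι₁ ≫ G = f'.map := by
  let φ := hornToBoundary 0 ▷ Δ[1] ≫ F.h
  have hφ₀ : ι₀ ≫ φ = SSet.const pt := by rw [ι₀_comp_assoc, F.h₀, hf]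
  have hφ₁ : ι₁ ≫ φ = SSet.const pt := by rw [ι₁_comp_assoc, F.h₁, hf']
  have hφ : (SSet.const (hornVertex n) : (Λ[n + 2, 0] : SSet.{u}) ⟶ _) ▷ Δ[1] ≫ φ =
      SSet.const pt := by
    let w : (Λ[n + 2, 0] : SSet.{u}) ⟶ basepoint (vertexZero.{u} n) :=
      SSet.const ⟨vertexZero n, Subcomplex.mem_ofSimplex_obj _⟩
    have hw : (SSet.const (hornVertex n) : (Λ[n + 2, 0] : SSet.{u}) ⟶ _) ▷ Δ[1] ≫
        hornToBoundary 0 ▷ Δ[1] = w ▷ Δ[1] ≫ (basepoint (vertexZero.{u} n)).ι ▷ Δ[1] := by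
      rw [← comp_whiskerRight, ← comp_whiskerRight]
      rfl
    dsimp only [φ]
    rw [← Category.assoc, hw, Category.assoc, F.rel]
    rfl
  have h₁ : stdSimplex.δ.{u} 2 ≫ stdSimplex.σ (0 : Fin 2) =
      SSet.const (stdSimplex.obj₀Equiv.symm 0) := by
    refine stdSimplex_hom_ext fun d x j ↦ ?_
    change (0 : Fin 2).predAbove ((2 : Fin 3).succAbove ((x : Δ[1] _⦋d⦌) j)) = 0
    generalize (x : Δ[1] _⦋d⦌) j = a
    decide +revert
  have h₂ : stdSimplex.δ.{u} 0 ≫ stdSimplex.σ (1 : Fin 2) =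
      SSet.const (stdSimplex.obj₀Equiv.symm 1) := by
    refine stdSimplex_hom_ext fun d x j ↦ ?_
    change (1 : Fin 2).predAbove ((0 : Fin 3).succAbove ((x : Δ[1] _⦋d⦌) j)) = 1
    generalize (x : Δ[1] _⦋d⦌) j = a
    decide +revert
  have h₀₀ : stdSimplex.δ.{u} 0 ≫ stdSimplex.σ (0 : Fin 2) = 𝟙 _ :=
    CosimplicialObject.δ_comp_σ_self _ (i := 0)
  have h₁₀ : stdSimplex.δ.{u} 1 ≫ stdSimplex.σ (0 : Fin 2) = 𝟙 _ :=
    CosimplicialObject.δ_comp_σ_succ _ (i := 0)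
  have h₁₁ : stdSimplex.δ.{u} 1 ≫ stdSimplex.σ (1 : Fin 2) = 𝟙 _ :=
    CosimplicialObject.δ_comp_σ_self _ (i := 1)
  have h₂₁ : stdSimplex.δ.{u} 2 ≫ stdSimplex.σ (1 : Fin 2) = 𝟙 _ :=
    CosimplicialObject.δ_comp_σ_succ _ (i := 1)
  -- Triangle `(0,0), (0,1), (1,1)`: the composite `c` restricts to the diagonal.
  obtain ⟨c, hc, hc₀, hc₁⟩ := exists_homotopy_comp (hornToBoundary 0)
    (contractionAlong (stdSimplex.σ (0 : Fin 2)) (stdSimplex.σ (1 : Fin 2)) ≫ φ)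
    (fst _ _ ≫ f.map) F.h (by rw [ι₁_fst_assoc, F.h₀]) (by
      rw [← Category.assoc (_ ◁ _), whiskerLeft_contractionAlong, h₁, h₂₁,
        const_zero_contractionAlong, Category.assoc, Category.assoc, hφ₀,
        whiskerRight_fst_assoc, hf]
      rfl) (by
      rw [← Category.assoc (_ ◁ _), whiskerLeft_contractionAlong, h₂, h₀₀,
        contractionAlong_const_one, whiskerLeft_id, Category.id_comp])
  rw [← Category.assoc (_ ◁ _), whiskerLeft_contractionAlong, h₁₀, h₁₁] at hc
  rw [ι₀_fst_assoc] at hc₀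
  -- Triangle `(0,0), (1,0), (1,1)`: the new edge is the side `s = 0`, constant by `hφ`.
  obtain ⟨G, hG, hG₀, hG₁⟩ := exists_homotopy_comp_inv (hornToBoundary 0)
    (contractionAlong (stdSimplex.σ (1 : Fin 2)) (stdSimplex.σ (0 : Fin 2)) ≫ φ)
    c (fst _ _ ≫ f'.map) (by rw [ι₁_fst_assoc, hc₁, F.h₁]) (by
      rw [← Category.assoc (_ ◁ _), whiskerLeft_contractionAlong, h₁₀, h₁₁, hc]) (by
      rw [← Category.assoc (_ ◁ _), whiskerLeft_contractionAlong, h₂, h₀₀,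
        const_one_contractionAlong, Category.assoc, Category.assoc, hφ₁,
        whiskerRight_fst_assoc, hf']
      rfl)
  rw [← Category.assoc (_ ◁ _), whiskerLeft_contractionAlong, h₁, h₂₁,
    contractionAlong_const_zero, whiskerLeft_id, Category.comp_id, hφ] at hG
  exact ⟨G, hG, by rw [hG₀, hc₀], by rw [hG₁, ι₀_fst_assoc]⟩

lemma IsCollapseExtension.homotopy_of_homotopy {g g' : X.PtSimplex (n + 1) pt}
    {f f' : PointedSphere pt n} (hf : IsCollapseExtension g f) (hf' : IsCollapseExtension g' f')
    (h : Nonempty (f.Homotopy f')) : Nonempty (g.Homotopy g') := by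
  rw [isCollapseExtension_iff] at hf hf'
  obtain ⟨F⟩ := h
  obtain ⟨G, hG, hG₀, hG₁⟩ := exists_homotopy_const_on_horn hf.2 hf'.2 F
  refine ⟨boundary.ι 0 ▷ Δ[1] ≫ G, ?_, ?_, ?_⟩
  · rw [ι₀_comp_assoc, hG₀, hf.1]
  · rw [ι₁_comp_assoc, hG₁, hf'.1]
  · rw [← comp_whiskerRight_assoc, (isPushout_boundary 0).w, comp_whiskerRight_assoc, hG]
    rfl

variable (pt n) in
/-- Homotopy classes of spherical simplices and of maps from the disk. -/
noncomputable def piSimplexEquivPiDisk : PiSimplex pt n ≃ PiDisk pt n :=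
  Quot.congr (sphericalSimplexEquiv pt n) simplexHomotopic_iff_nonempty_homotopy

variable (X pt n) in
/-- The map from homotopy classes of disks to homotopy classes of spheres. -/
noncomputable def piDiskToPiSphere : PiDisk pt n → PiSphere pt n :=
  Quot.map collapseExtension fun g g' ↦
    (isCollapseExtension_collapseExtension g).homotopy (isCollapseExtension_collapseExtension g')

lemma bijective_piDiskToPiSphere : Function.Bijective (piDiskToPiSphere X pt n) := by
  constructor
  · rintro ⟨g⟩ ⟨g'⟩ h
    exact Quot.sound ((isCollapseExtension_collapseExtension g).homotopy_of_homotopy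
      (isCollapseExtension_collapseExtension g') (equivalence_homotopy.quot_mk_eq_iff _ _ |>.1 h))
  · rintro ⟨f⟩
    obtain ⟨g, f', h, hf⟩ := exists_isCollapseExtension_homotopy f
    obtain rfl := (existsUnique_isCollapseExtension g).unique
      (isCollapseExtension_collapseExtension g) h
    exact ⟨Quot.mk _ g, Quot.sound hf⟩

end
end KanPi

/-- Dimension `n + 1` ranges over all positive dimensions. -/
theorem mainTheorem2 (X : SSet.{u}) [SSet.KanComplex X] (pt : X _⦋0⦌) (n : ℕ) :
    -- the three homotopy relations are equivalence relations
    Equivalence (fun x x' : KanPi.SphericalSimplex pt n ↦ KanPi.SimplexHomotopic x.1 x'.1) ∧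
    Equivalence (fun g g' : X.PtSimplex (n + 1) pt ↦ Nonempty (g.Homotopy g')) ∧
    Equivalence (fun f f' : KanPi.PointedSphere pt n ↦ Nonempty (f.Homotopy f')) ∧
    -- simplices are homotopic iff the maps representing them are homotopic rel boundary
    (∀ x x' : X _⦋n + 1⦌, KanPi.SimplexHomotopic x x' ↔
      KanPi.HomotopicRel ∂Δ[n + 1] (SSet.yonedaEquiv.symm x) (SSet.yonedaEquiv.symm x')) ∧
    -- every spherical simplex is represented by a map of pairs, which extends to the sphere
    (∀ x : KanPi.SphericalSimplex pt n,
      ∃! g : X.PtSimplex (n + 1) pt, SSet.yonedaEquiv g.map = x.1) ∧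
    (∀ g : X.PtSimplex (n + 1) pt,
      ∃! f : KanPi.PointedSphere pt n, KanPi.IsCollapseExtension g f) ∧
    -- and this gives bijections on homotopy classes
    ∃ (e₁ : KanPi.PiSimplex pt n ≃ KanPi.PiDisk pt n)
      (e₂ : KanPi.PiDisk pt n ≃ KanPi.PiSphere pt n),
      (∀ (x : KanPi.SphericalSimplex pt n) (g : X.PtSimplex (n + 1) pt),
        SSet.yonedaEquiv g.map = x.1 → e₁ (Quot.mk _ x) = g.homotopyClass) ∧
      (∀ (g : X.PtSimplex (n + 1) pt) (f : KanPi.PointedSphere pt n),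
        KanPi.IsCollapseExtension g f → e₂ g.homotopyClass = f.homotopyClass) := by
  -- Symmetry and transitivity are not visible on simplices; they are transported from relative
  -- homotopy.
  have hS : Equivalence
      (fun x x' : KanPi.SphericalSimplex pt n ↦ KanPi.SimplexHomotopic x.1 x'.1) := by
    simp only [KanPi.simplexHomotopic_iff]
    exact ⟨fun _ ↦ .refl _ _, .symm, .trans⟩
  refine ⟨hS, KanPi.equivalence_homotopy, KanPi.equivalence_homotopy, KanPi.simplexHomotopic_iff,
    fun x ↦ ?_, KanPi.existsUnique_isCollapseExtension, KanPi.piSimplexEquivPiDisk pt n,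
    Equiv.ofBijective _ KanPi.bijective_piDiskToPiSphere, fun x g h ↦ ?_, fun g f h ↦ ?_⟩
  · exact ⟨KanPi.sphericalSimplexEquiv pt n x,
      (KanPi.sphericalSimplexEquiv_apply_eq_iff _ _).2 rfl,
      fun g hg ↦ (KanPi.sphericalSimplexEquiv_apply_eq_iff _ _).1 hg⟩
  · rw [(KanPi.sphericalSimplexEquiv_apply_eq_iff _ _).1 h]
    rfl
  · rw [(KanPi.existsUnique_isCollapseExtension g).unique h
      (KanPi.isCollapseExtension_collapseExtension g)]
    rfl
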